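/- Let $(W,S)$ be a right-angled Coxeter system of finite rank (that is, $S$ is finite and $m_{st}\in\{2,\infty\}$ for all $s\neq t$ in $S$), with length function $l$, and let $\Delta$ be a building of type $(W,S)$ with Weyl distance $\delta$, regarded as a chamber system in which each panel has at least two chambers. The gallery distance of two chambers is $d_W(c,c') = l(\delta(c,c'))$. Fix a chamber $c_0$, and for $n\in\mathbb{N}$ put $\mathrm{S}(c_0,n)=\{c : d_W(c_0,c)=n\}$ and $\mathrm{B}(c_0,n)=\{c : d_W(c_0,c)\le n\}$. An element $w\neq 1$ of $W$ is *firm* if all reduced words representing $w$ end with the same letter; the identity is not firm. The *firmness* $F^\#(w)$ is the largest $k$ such that $w$ is represented by a reduced word $s_1\cdots s_k t_{k+1}\cdots t_\ell$ with $s_1\cdots s_k$ firm, and $F^\#(1)=0$. A chamber $c$ is *firm with respect to $c_0$* if $\delta(c_0,c)$ is firm. A chamber $c$ is *$n$-flexible with respect to $c_0$* if either $c\in \mathrm{B}(c_0,n)$, or $k:=d_W(c_0,c)>n$ and for each minimal gallery $(c_0,c_1,\dots,c_k=c)$ none of the chambers $c_{n+1},\dots,c_k$ is firm with respect to $c_0$.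 Let $\mathrm{Flex}(c_0,n)$ be the set of all chambers that are $n$-flexible with respect to $c_0$. A set $\mathscr{C}$ of chambers is *closed under squares with respect to $c_0$* if the following holds for all $n\ge 1$ and all $s\neq t$ in $S$ with $m_{st}=2$: if $c_1,c_2\in\mathscr{C}\cap \mathrm{S}(c_0,n)$ and $c_4\in\mathscr{C}\cap \mathrm{S}(c_0,n-1)$ are such that $c_4$ is $s$-adjacent to $c_1$ and $t$-adjacent to $c_2$, then the unique chamber $c_3\in \mathrm{S}(c_0,n+1)$ that is $t$-adjacent to $c_1$ and $s$-adjacent to $c_2$ is also in $\mathscr{C}$. The *square closure* of a set $\mathscr{C}$ of chambers with respect to $c_0$ is the smallest set of chambers that contains $\mathscr{C}$ and is closed under squares with respect to $c_0$. **Theorem.** For every chamber $c_0$ of $\Delta$ and every $n\in\mathbb{N}$ (including $n = 0$), the square closure of $\mathrm{B}(c_0,n)$ with respect to $c_0$ is $\mathrm{Flex}(c_0,n)$, and $$\mathrm{Flex}(c_0,n)=\{c : F^\#(\delta(c_0,c))\le n\}.$$ Moreover, the set $\mathrm{Flex}(c_0,n)$ is bounded, i.e., it has finite diameter for the gallery distance.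 -/

import Mathlib

/-- A Coxeter matrix is right-angled if all its off-diagonal entries are `2` or `∞`
(an infinite entry is encoded by `0`). -/
def CoxeterMatrix.IsRightAngled {S : Type*} (M : CoxeterMatrix S) : Prop :=
  ∀ s t : S, s ≠ t → M s t = 2 ∨ M s t = 0

namespace CoxeterSystem

variable {S W : Type*} [Group W] {M : CoxeterMatrix S} (cs : CoxeterSystem M W)

/-- An element `w` is firm if all its reduced representations end with the same letter.
(The identity, which has no last letter, is not firm.) -/
def IsFirm (w : W) : Prop :=
  ∃ s : S, ∀ ω : List S, cs.IsReduced ω → cs.wordProd ω = w → ω.getLast? = some s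

/-- The firmness `F^#(w)`: the largest `k` such that `w` has a reduced representation
`s₁ ⋯ s_k t_{k+1} ⋯ t_ℓ` with `s₁ ⋯ s_k` firm. The set of such `k` is bounded by the length of `w`;
it is empty only for `w = 1`, which gets firmness `0`. -/
noncomputable def firmness (w : W) : ℕ :=
  sSup {k : ℕ | ∃ u t : List S, cs.IsReduced (u ++ t) ∧ cs.wordProd (u ++ t) = w ∧
    u.length = k ∧ cs.IsFirm (cs.wordProd u)}

end CoxeterSystem

/-- A chamber system with index set `S` on the set of chambers `C`: an edge-coloured graph with
colour set `S`, given by the graph `adj s` of the edges of colour `s` for each `s`, such that for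
each `s` all `s`-panels (the connected components of `adj s`) are complete graphs with at least
two vertices. -/
structure ChamberSystem (S C : Type*) where
  /-- The graph formed by the edges of colour `s`. -/
  adj : S → SimpleGraph C
  /-- Every edge has only one colour. -/
  color_unique : ∀ s t x y, (adj s).Adj x y → (adj t).Adj x y → s = t
  /-- Panels are complete graphs. -/
  panel_complete : ∀ s x y, (adj s).Reachable x y → x ≠ y → (adj s).Adj x y
  /-- Panels have at least two chambers. -/
  exists_adj : ∀ s x, ∃ y, (adj s).Adj x y

namespace ChamberSystem

variable {S C : Type*} (Δ : ChamberSystem S C)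

/-- The underlying graph: two chambers are adjacent if they are `s`-adjacent for some `s`.
Galleries are the walks in this graph. -/
def graph : SimpleGraph C := ⨆ s, Δ.adj s

/-- There is a gallery of type `ω` from the first to the second chamber. -/
def ExistsGallery : List S → C → C → Prop
  | [], x, y => x = y
  | s :: ω, x, y => ∃ z, (Δ.adj s).Adj x z ∧ ExistsGallery ω z y

/-- A gallery is minimal if there is no shorter gallery with the same extremities. -/
def IsMinimalGallery {x y : C} (γ : Δ.graph.Walk x y) : Prop :=
  ∀ γ' : Δ.graph.Walk x y, γ.length ≤ γ'.length

end ChamberSystem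

/-- A building of type `(W, S)` with set of chambers `C`. -/
structure Building {S W : Type*} [Group W] {M : CoxeterMatrix S} (cs : CoxeterSystem M W)
    (C : Type*) extends ChamberSystem S C where
  /-- The Weyl distance. -/
  δ : C → C → W
  δ_eq_iff : ∀ (ω : List S) (x y : C), cs.IsReduced ω →
    (δ x y = cs.wordProd ω ↔ toChamberSystem.ExistsGallery ω x y)

namespace Building

variable {S W C : Type*} [Group W] {M : CoxeterMatrix S} {cs : CoxeterSystem M W}
  (Δ : Building cs C)

/-- The gallery distance between two chambers. -/
noncomputable def galleryDist (x y : C) : ℕ := cs.length (Δ.δ x y)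

/-- The sphere of radius `n` around `c₀`. -/
def sphere (c₀ : C) (n : ℕ) : Set C := {c | Δ.galleryDist c₀ c = n}

/-- The ball of radius `n` around `c₀`. -/
def ball (c₀ : C) (n : ℕ) : Set C := {c | Δ.galleryDist c₀ c ≤ n}

/-- A set of chambers is bounded if it has finite diameter for the gallery distance. -/
def IsBounded (A : Set C) : Prop := ∃ d : ℕ, ∀ x ∈ A, ∀ y ∈ A, Δ.galleryDist x y ≤ d

/-- The chamber `c` is firm with respect to `c₀`. -/
def IsFirm (c₀ c : C) : Prop := cs.IsFirm (Δ.δ c₀ c)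

/-- The chamber `c` is `n`-flexible with respect to `c₀`: it lies in the ball of radius `n`, or
on each minimal gallery `(c₀, c₁, …, c_k = c)` none of the chambers `c_{n+1}, …, c_k` is firm. -/
def IsFlexible (c₀ : C) (n : ℕ) (c : C) : Prop :=
  c ∈ Δ.ball c₀ n ∨
    ∀ γ : Δ.graph.Walk c₀ c, Δ.IsMinimalGallery γ →
      ∀ i : ℕ, n < i → i ≤ γ.length → ¬ Δ.IsFirm c₀ (γ.getVert i)

/-- The `n`-flex of `c₀`. -/
def flex (c₀ : C) (n : ℕ) : Set C := {c | Δ.IsFlexible c₀ n c}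

/-- A set of chambers `A` is closed under squares with respect to `c₀`: if two chambers
`c₁, c₂ ∈ A` at distance `n + 1` from `c₀` are `s`-adjacent and `t`-adjacent, respectively, to a
chamber `c₄ ∈ A` at distance `n`, where `s ≠ t` commute, then the chamber `c₃` at distance `n + 2`
that completes the square is in `A`. -/
def ClosedUnderSquares (c₀ : C) (A : Set C) : Prop :=
  ∀ (n : ℕ) (s t : S) (c₁ c₂ c₃ c₄ : C), s ≠ t → M s t = 2 →
    c₁ ∈ A ∩ Δ.sphere c₀ (n + 1) → c₂ ∈ A ∩ Δ.sphere c₀ (n + 1) → c₄ ∈ A ∩ Δ.sphere c₀ n →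
    (Δ.adj s).Adj c₄ c₁ → (Δ.adj t).Adj c₄ c₂ →
    c₃ ∈ Δ.sphere c₀ (n + 2) → (Δ.adj t).Adj c₃ c₁ → (Δ.adj s).Adj c₃ c₂ → c₃ ∈ A

/-- The square closure of `A` with respect to `c₀`. -/
def squareClosure (c₀ : C) (A : Set C) : Set C :=
  ⋂₀ {T : Set C | A ⊆ T ∧ Δ.ClosedUnderSquares c₀ T}

/-- The square closure is the smallest set that contains `A` and is closed under squares. -/
theorem isLeast_squareClosure (c₀ : C) (A : Set C) :
    IsLeast {T : Set C | A ⊆ T ∧ Δ.ClosedUnderSquares c₀ T} (Δ.squareClosure c₀ A) := by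
  refine ⟨⟨fun x hx T hT => hT.1 hx, ?_⟩, fun T hT => Set.sInter_subset_of_mem hT⟩
  intro n s t c₁ c₂ c₃ c₄ hst hM h₁ h₂ h₄ a₁ a₂ h₃ a₃ a₄ T hT
  exact hT.2 n s t c₁ c₂ c₃ c₄ hst hM ⟨h₁.1 T hT, h₁.2⟩ ⟨h₂.1 T hT, h₂.2⟩ ⟨h₄.1 T hT, h₄.2⟩
    a₁ a₂ h₃ a₃ a₄

end Building

/-!
The proof has three ingredients.

*Descents.* A letter `i` is a descent of `w` if some reduced word of `w` ends with `i`; so `w` is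
firm iff it has exactly one descent. The exchange condition (`simple_mem_rightInvSeq`) follows from
an action of `W` on `W × ℤ/2` that computes the parity of the number of occurrences of an element in
the right inversion sequence of a word. Together with the retraction of `W` onto the infinite
dihedral group generated by `s_i` and `s_j` when `m_{ij} = ∞`, it shows that two distinct descents
of an element commute (`eq_two_of_isRightDescent`).

*Firmness.* The firmness of `w` is the largest length of a firm prefix of `w`. If `i` is a descent
of `w` and `u` is a prefix of `w`, then `u` is a prefix of `w s_i` or `i` is a descent of `u`
(`IsPrefix.mul_simple_or`). Hence, if `w` has descents `i ≠ j`, each firm prefix of `w` is a prefix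
of `w s_i` or of `w s_j`: completing a square does not increase the firmness. Conversely an element
longer than its firmness is not firm, so it has two commuting descents and is the top of a square.
Finally, if a letter occurs `m` times in a reduced word of `w`, a shortest prefix that still has
`m` occurrences of it is firm, whence `ℓ(w) ≤ |S| F^#(w)` (`length_le_card_mul_firmness`).

*Buildings.* Minimal galleries from `c₀` to `c` correspond to reduced words of `δ c₀ c`, so the
chambers that occur on them realize exactly the prefixes of `δ c₀ c`; this turns flexibility into a
bound on the firmness (`isFlexible_iff`). Squares in the Weyl group lift to squares in the building
by `δ_eq_mul_iff`, and induction on the distance from `c₀` identifies the square closure of a ball.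
-/

namespace CoxeterSystem

variable {S W : Type*} [Group W] {M : CoxeterMatrix S} (cs : CoxeterSystem M W)

/-! ### The exchange condition -/

open Classical in
/-- The map `(r, ε) ↦ (s r s, ε + [r = s])` on `W × ℤ/2` attached to a simple reflection `s`. The
second coordinate records the parity with which `r` occurs in the right inversion sequence of a
word. -/
noncomputable def signMap (i : S) (p : W × ZMod 2) : W × ZMod 2 :=
  (cs.simple i * p.1 * cs.simple i, p.2 + Pi.single (M := fun _ => ZMod 2) (cs.simple i) 1 p.1)

open Classical in
theorem single_simple_conj {i j : S} (h : cs.simple i * cs.simple j = cs.simple j * cs.simple i)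
    (r : W) : Pi.single (M := fun _ => ZMod 2) (cs.simple j) 1 (cs.simple i * r * cs.simple i) =
      Pi.single (M := fun _ => ZMod 2) (cs.simple j) 1 r := by
  have : cs.simple i * r * cs.simple i = cs.simple j ↔ r = cs.simple j := by
    constructor
    · intro h'
      rw [← mul_right_inj (cs.simple i), ← mul_left_inj (cs.simple i), h', h]
      simp [mul_assoc]
    · rintro rfl
      simp [h, mul_assoc]
  simp only [Pi.single_apply, this]

theorem simple_mul_comm_of_eq_two {i j : S} (h : M i j = 2) :
    cs.simple i * cs.simple j = cs.simple j * cs.simple i := by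
  have h1 := cs.simple_mul_simple_pow i j
  rw [h, pow_two] at h1
  simpa using eq_inv_of_mul_eq_one_left h1

/-- For a right-angled system the maps `signMap` satisfy the Coxeter relations, because commuting
simple reflections are fixed by conjugation by each other. -/
theorem isLiftable_signMap (hM : M.IsRightAngled) :
    M.IsLiftable (G := Function.End (W × ZMod 2)) cs.signMap := by
  intro i j
  have two (a : ZMod 2) : a + a = 0 := CharTwo.add_self_eq_zero a
  by_cases hij : i = j
  · subst hij
    rw [M.diagonal, pow_one]
    funext p
    change cs.signMap i (cs.signMap i p) = p
    simp only [signMap, cs.single_simple_conj rfl, add_assoc, two]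
    simp [mul_assoc]
  rcases hM i j hij with h | h
  · rw [h, pow_two]
    have hc := cs.simple_mul_comm_of_eq_two h
    funext p
    change cs.signMap i (cs.signMap j (cs.signMap i (cs.signMap j p))) = p
    simp only [signMap, cs.single_simple_conj rfl, cs.single_simple_conj hc,
      cs.single_simple_conj hc.symm]
    refine Prod.ext ?_ ?_
    · have hc' (w : W) : cs.simple i * (cs.simple j * w) = cs.simple j * (cs.simple i * w) := by
        rw [← mul_assoc, hc, mul_assoc]
      simp [mul_assoc, hc, hc']
    · have (a b c : ZMod 2) : a + b + c + b + c = a := by decide +revert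
      exact this _ _ _
  · rw [h, pow_zero]

open Classical in
/-- The parity of the number of occurrences of `r` in the right inversion sequence of a word
depends only on the element that the word represents. -/
theorem count_rightInvSeq_congr (hM : M.IsRightAngled) {ω ω' : List S}
    (h : cs.wordProd ω = cs.wordProd ω') (r : W) :
    ((cs.rightInvSeq ω).count r : ZMod 2) = (cs.rightInvSeq ω').count r := by
  let φ := cs.lift (G := Function.End (W × ZMod 2)) ⟨cs.signMap, cs.isLiftable_signMap hM⟩
  have hφ (i : S) : φ (cs.simple i) = cs.signMap i := cs.lift_apply_simple _ i
  have key (ω : List S) : φ (cs.wordProd ω) (r, 0) =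
      (cs.wordProd ω * r * (cs.wordProd ω)⁻¹, ((cs.rightInvSeq ω).count r : ZMod 2)) := by
    induction ω with
    | nil => simp [Function.End.one_def]
    | cons i ω ih =>
      rw [cs.wordProd_cons, map_mul, hφ]
      change cs.signMap i (φ (cs.wordProd ω) (r, 0)) = _
      rw [ih]
      have : cs.wordProd ω * r * (cs.wordProd ω)⁻¹ = cs.simple i ↔
          (cs.wordProd ω)⁻¹ * cs.simple i * cs.wordProd ω = r := by
        constructor
        · intro h; rw [← h]; group
        · intro h; rw [← h]; group
      simp only [signMap, rightInvSeq, List.count_cons, Pi.single_apply, this, beq_iff_eq]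
      simp [mul_assoc]
  have := key ω
  rw [h, key ω'] at this
  exact (Prod.ext_iff.1 this).2.symm

theorem rightInvSeq_append (ω ω' : List S) : cs.rightInvSeq (ω ++ ω') =
    (cs.rightInvSeq ω).map (MulAut.conj (cs.wordProd ω')⁻¹) ++ cs.rightInvSeq ω' := by
  induction ω with
  | nil => simp
  | cons i ω ih => simp [rightInvSeq, ih, cs.wordProd_append, mul_assoc]

theorem exists_isReduced_concat {w : W} {i : S} (h : cs.IsRightDescent w i) :
    ∃ ω, cs.IsReduced ω ∧ cs.IsReduced (ω ++ [i]) ∧ cs.wordProd ω = w * cs.simple i ∧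
      cs.wordProd (ω ++ [i]) = w := by
  obtain ⟨ω, hω, hw⟩ := cs.exists_isReduced (w * cs.simple i)
  have h1 : cs.wordProd (ω ++ [i]) = w := by simp [cs.wordProd_append, ← hw]
  refine ⟨ω, hω, ?_, hw.symm, h1⟩
  have h2 := cs.isRightDescent_iff.1 h
  rw [IsReduced, h1, List.length_append, ← hω.eq, ← hw, ← h2]; rfl

/-- The exchange condition, in terms of inversion sequences. -/
theorem simple_mem_rightInvSeq (hM : M.IsRightAngled) {ω : List S} {i : S}
    (h : cs.IsRightDescent (cs.wordProd ω) i) : cs.simple i ∈ cs.rightInvSeq ω := by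
  classical
  obtain ⟨ω', -, hr, -, hw⟩ := cs.exists_isReduced_concat h
  have h1 := cs.count_rightInvSeq_congr hM hw (cs.simple i)
  rw [List.count_eq_one_of_mem hr.nodup_rightInvSeq (by simp [rightInvSeq_append])] at h1
  by_contra hn
  rw [List.count_eq_zero_of_not_mem hn] at h1
  exact absurd h1 (by decide)

/-- The exchange condition. -/
theorem exists_eraseIdx (hM : M.IsRightAngled) {ω : List S} {i : S}
    (h : cs.IsRightDescent (cs.wordProd ω) i) :
    ∃ j < ω.length, cs.wordProd ω * cs.simple i = cs.wordProd (ω.eraseIdx j) := by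
  obtain ⟨j, hj, hi⟩ := List.mem_iff_getElem.1 (cs.simple_mem_rightInvSeq hM h)
  refine ⟨j, by simpa using hj, ?_⟩
  rw [← cs.wordProd_mul_getD_rightInvSeq, List.getD_eq_getElem _ _ hj, hi]

/-! ### Homomorphisms out of a right-angled Coxeter group -/

open Classical in
/-- Since all entries of a right-angled Coxeter matrix off the diagonal are even or infinite, the
parity of the number of occurrences of a letter in a word depends only on the element that the
word represents. -/
theorem count_congr (hM : M.IsRightAngled) {ω ω' : List S}
    (h : cs.wordProd ω = cs.wordProd ω') (i : S) :
    (ω.count i : ZMod 2) = ω'.count i := by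
  let f : S → Multiplicative (ZMod 2) := fun k => Multiplicative.ofAdd (if k = i then 1 else 0)
  have sq (x : Multiplicative (ZMod 2)) : x * x = 1 := CharTwo.add_self_eq_zero x.toAdd
  have hf : M.IsLiftable f := by
    intro a b
    by_cases hab : a = b
    · rw [hab, M.diagonal, pow_one, sq]
    · rcases hM a b hab with h | h
      · rw [h, pow_two, sq]
      · rw [h, pow_zero]
  have key (ω : List S) :
      cs.lift ⟨f, hf⟩ (cs.wordProd ω) = Multiplicative.ofAdd (ω.count i : ZMod 2) := by
    induction ω with
    | nil => simp
    | cons k ω ih =>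
      rw [cs.wordProd_cons, map_mul, ih, cs.lift_apply_simple, ← ofAdd_add]
      simp [List.count_cons, add_comm]
  have := key ω
  rw [h, key ω'] at this
  exact (Multiplicative.ofAdd.injective this).symm

theorem simple_injective_of_isRightAngled (hM : M.IsRightAngled) {i j : S}
    (h : cs.simple i = cs.simple j) : i = j := by
  classical
  have := cs.count_congr hM (ω := [i]) (ω' := [j]) (by simpa using h) i
  by_contra hn
  simp [Ne.symm hn] at this

open Classical in
/-- Multiplying by a descent `i` deletes a letter `i`, so it leaves the other letters alone. -/
theorem exists_word_mul_simple (hM : M.IsRightAngled) {ω : List S} {i : S}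
    (h : cs.IsRightDescent (cs.wordProd ω) i) :
    ∃ ω', ω'.length + 1 = ω.length ∧ cs.wordProd ω * cs.simple i = cs.wordProd ω' ∧
      ∀ k ≠ i, ω'.count k = ω.count k := by
  obtain ⟨j, hj, he⟩ := cs.exists_eraseIdx hM h
  refine ⟨_, List.length_eraseIdx_add_one hj, he, ?_⟩
  have hp (k : S) := (List.getElem_cons_eraseIdx_perm hj).count_eq k
  simp only [List.count_cons] at hp
  have hi : ω[j] = i := by
    by_contra hn
    have h1 := cs.count_congr hM (ω := ω ++ [i]) (ω' := ω.eraseIdx j)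
      (by simpa [cs.wordProd_append] using he) i
    have h2 := hp i
    simp only [beq_iff_eq, hn, if_false, add_zero] at h2
    simp [h2] at h1
  intro k hk
  simpa [hi, Ne.symm hk] using hp k

/-- Two simple reflections `s_i`, `s_j` with `m_{ij} = ∞` generate an infinite dihedral group,
onto which `W` retracts. -/
theorem simple_mul_simple_pow_ne_one (hM : M.IsRightAngled) {i j : S} (hij : i ≠ j)
    (h : M i j = 0) (k : ℕ) : (cs.simple i * cs.simple j) ^ (k + 1) ≠ 1 := by
  classical
  let f : S → DihedralGroup 0 := fun a =>
    if a = i then .sr 0 else if a = j then .sr 1 else 1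
  have sq (a : S) : f a * f a = 1 := by
    unfold f
    split_ifs <;> simp
  have hf : M.IsLiftable f := by
    intro a b
    by_cases hab : a = b
    · rw [hab, M.diagonal, pow_one, sq]
    · rcases hM a b hab with h' | h'
      · have : f a = 1 ∨ f b = 1 := by
          by_contra! hn
          have ha : a = i ∨ a = j := by
            by_contra! ha; exact hn.1 (by simp [f, ha])
          have hb : b = i ∨ b = j := by
            by_contra! hb; exact hn.2 (by simp [f, hb])
          rcases ha with rfl | rfl <;> rcases hb with rfl | rfl
          · exact hab rfl
          · omega
          · rw [M.symmetric] at h'; omega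
          · exact hab rfl
        rw [h', pow_two]
        rcases this with h1 | h1 <;> simp [h1, sq]
      · rw [h', pow_zero]
  intro hk
  have := congrArg (cs.lift ⟨f, hf⟩) hk
  rw [map_pow, map_mul, cs.lift_apply_simple, cs.lift_apply_simple, map_one] at this
  simp only [f, if_true, if_neg hij.symm, DihedralGroup.sr_mul_sr, sub_zero] at this
  rw [DihedralGroup.r_one_pow, DihedralGroup.one_def] at this
  have h0 := DihedralGroup.r.inj this
  have h1 : ((k + 1 : ℕ) : ℤ) = 0 := h0
  omega

/-! ### Right descents -/

/-- The inversions of an alternating word ending with `i` have the form `(s_i s_j)^p s_i`. -/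
theorem exists_pow_of_mem_rightInvSeq_alternatingWord (m : ℕ) :
    ∀ (i j : S) (r : W), r ∈ cs.rightInvSeq (alternatingWord j i m) →
      ∃ p : ℕ, r = (cs.simple i * cs.simple j) ^ p * cs.simple i := by
  induction m with
  | zero => intro i j r h; simp [alternatingWord] at h
  | succ m ih =>
    intro i j r h
    rw [alternatingWord_succ, rightInvSeq_concat, List.concat_eq_append, List.mem_append,
      List.mem_map, List.mem_singleton] at h
    rcases h with ⟨x, hx, rfl⟩ | rfl
    · obtain ⟨p, rfl⟩ := ih j i x hx
      refine ⟨p + 1, ?_⟩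
      have : (cs.simple i * cs.simple j) ^ p =
          cs.simple i * (cs.simple j * cs.simple i) ^ p * cs.simple i := by
        clear hx ih
        induction p with
        | zero => simp
        | succ p ih => rw [pow_succ, ih, pow_succ]; simp [mul_assoc]
      rw [pow_succ, this]
      simp [mul_assoc]
    · exact ⟨0, by simp⟩

/-- If `m_{ij} = ∞` and both `i` and `j` were descents of `w`, then each alternating word in `i`
and `j` could be split off from `w` on the right, which is absurd once such a word is longer than
`w`. -/
theorem length_mul_alternatingWord_inv_le (hM : M.IsRightAngled) {w : W} (k : ℕ) :
    ∀ {i j : S}, i ≠ j → M i j = 0 → cs.IsRightDescent w i → cs.IsRightDescent w j →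
      cs.length (w * (cs.wordProd (alternatingWord i j k))⁻¹) + k ≤ cs.length w := by
  induction k with
  | zero => intros; simp [alternatingWord]
  | succ k ih =>
    intro i j hij h0 hi hj
    have hv := ih hij.symm (by rwa [M.symmetric]) hj hi
    rw [alternatingWord_succ, wordProd_concat, mul_inv_rev, inv_simple, ← mul_assoc]
    set A := alternatingWord j i k with hA
    obtain ⟨ν, hν, hνw⟩ := cs.exists_isReduced (w * (cs.wordProd A)⁻¹)
    have hw : cs.wordProd (ν ++ A) = w := by rw [wordProd_append, ← hνw]; group
    rw [← hw] at hj
    have hmem := cs.simple_mem_rightInvSeq hM hj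
    rw [rightInvSeq_append, List.mem_append] at hmem
    rcases hmem with hmem | hmem
    · obtain ⟨x, hx, hxj⟩ := List.mem_map.1 hmem
      obtain ⟨n, hn, rfl⟩ := List.mem_iff_getElem.1 hx
      have hn' : n < ν.length := by simpa using hn
      have : w * cs.simple j * (cs.wordProd A)⁻¹ = cs.wordProd (ν.eraseIdx n) := by
        rw [← cs.wordProd_mul_getD_rightInvSeq, List.getD_eq_getElem _ _ hn, ← hνw, ← hxj]
        simp [mul_assoc]
      rw [this]
      have h1 := cs.length_wordProd_le (ν.eraseIdx n)
      have h2 := List.length_eraseIdx_add_one hn'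
      have h3 := hν.eq
      rw [← hνw] at h3
      omega
    · -- here `s_j` would be a product of the form `(s_i s_j)^p s_i`
      obtain ⟨p, hp⟩ := cs.exists_pow_of_mem_rightInvSeq_alternatingWord k i j _ hmem
      refine absurd ?_ (cs.simple_mul_simple_pow_ne_one hM hij h0 p)
      rw [pow_succ, ← mul_assoc, ← hp, simple_mul_simple_self]

/-- Two distinct descents of an element commute. -/
theorem eq_two_of_isRightDescent (hM : M.IsRightAngled) {w : W} {i j : S} (hij : i ≠ j)
    (hi : cs.IsRightDescent w i) (hj : cs.IsRightDescent w j) : M i j = 2 := by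
  refine (hM i j hij).resolve_right fun h0 => ?_
  have := cs.length_mul_alternatingWord_inv_le hM (cs.length w + 1) hij h0 hi hj
  omega

/-- If `i ≠ j` are descents of `w`, then `i` is still a descent of `w s_j`. -/
theorem IsRightDescent.mul_simple (hM : M.IsRightAngled) {w : W} {i j : S} (hij : i ≠ j)
    (hi : cs.IsRightDescent w i) (hj : cs.IsRightDescent w j) :
    cs.IsRightDescent (w * cs.simple j) i := by
  obtain ⟨ω, -, hωi, hw, hw'⟩ := cs.exists_isReduced_concat hi
  rw [← hw'] at hj
  have hmem := cs.simple_mem_rightInvSeq hM hj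
  rw [rightInvSeq_append, List.mem_append] at hmem
  rcases hmem with hmem | hmem
  · obtain ⟨x, hx, hxj⟩ := List.mem_map.1 hmem
    obtain ⟨n, hn, rfl⟩ := List.mem_iff_getElem.1 hx
    have hn' : n < ω.length := by simpa using hn
    have : w * cs.simple j * cs.simple i = cs.wordProd (ω.eraseIdx n) := by
      rw [← cs.wordProd_mul_getD_rightInvSeq, List.getD_eq_getElem _ _ hn, hw, ← hxj]
      simp [mul_assoc]
    have h1 := cs.length_wordProd_le (ω.eraseIdx n)
    have h2 := List.length_eraseIdx_add_one hn'
    have h3 := hωi.eq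
    rw [hw'] at h3 hj
    have h4 := cs.isRightDescent_iff.1 hj
    simp at h3
    rw [IsRightDescent, this]
    omega
  · -- the deleted letter cannot be the final `i`, since `s_i ≠ s_j`
    simp at hmem
    exact absurd (cs.simple_injective_of_isRightAngled hM hmem).symm hij

/-! ### The weak order and firmness -/

/-- `u` is a prefix of `w` if some reduced word of `w` has an initial segment representing `u`
(the right weak order). This is encoded by the additivity of lengths in `w = u (u⁻¹ w)`; see
`isPrefix_iff` for the description by words. -/
def IsPrefix (u w : W) : Prop := cs.length u + cs.length (u⁻¹ * w) = cs.length w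

variable {cs}

theorem IsPrefix.refl (w : W) : cs.IsPrefix w w := by simp [IsPrefix]

theorem IsPrefix.trans {u v w : W} (h : cs.IsPrefix u v) (h' : cs.IsPrefix v w) :
    cs.IsPrefix u w := by
  unfold IsPrefix at *
  have h1 := cs.length_mul_le (u⁻¹ * v) (v⁻¹ * w)
  have h2 := cs.length_mul_le u (u⁻¹ * w)
  simp [mul_assoc] at h1 h2
  omega

theorem IsPrefix.length_le {u w : W} (h : cs.IsPrefix u w) : cs.length u ≤ cs.length w := by
  unfold IsPrefix at h; omega

theorem IsRightDescent.isPrefix {w : W} {i : S} (h : cs.IsRightDescent w i) :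
    cs.IsPrefix (w * cs.simple i) w := by
  have := cs.isRightDescent_iff.1 h
  simp [IsPrefix, mul_assoc, this]

variable (cs)

theorem isPrefix_iff (u w : W) : cs.IsPrefix u w ↔ ∃ α β : List S, cs.IsReduced (α ++ β) ∧
    cs.wordProd (α ++ β) = w ∧ α.length = cs.length u ∧ cs.wordProd α = u := by
  constructor
  · intro h
    obtain ⟨α, hα, rfl⟩ := cs.exists_isReduced u
    obtain ⟨β, hβ, hw⟩ := cs.exists_isReduced ((cs.wordProd α)⁻¹ * w)
    have : cs.wordProd (α ++ β) = w := by rw [wordProd_append, ← hw]; group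
    refine ⟨α, β, ?_, this, hα.eq.symm, rfl⟩
    rw [IsReduced, this, ← h, hw, hα.eq, hβ.eq, List.length_append]
  · rintro ⟨α, β, h, rfl, hl, rfl⟩
    have hβ : cs.IsReduced β := by simpa using h.drop α.length
    have := h.eq
    rw [IsPrefix, this]
    simp [wordProd_append, hβ.eq, hl]

/-- Removing a letter from the end of `v` either keeps a given prefix of `v`, or the letter is
also a descent of the prefix. -/
theorem IsPrefix.mul_simple_or (hM : M.IsRightAngled) {u v : W} (h : cs.IsPrefix u v) {i : S}
    (hi : cs.IsRightDescent v i) :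
    cs.IsPrefix u (v * cs.simple i) ∨ cs.IsRightDescent u i := by
  induction hn : cs.length v generalizing v with
  | zero => simp [IsRightDescent, hn] at hi
  | succ n ih =>
    by_cases huv : u = v
    · exact Or.inr (huv ▸ hi)
    obtain ⟨r, hr⟩ := cs.exists_rightDescent_of_ne_one (w := u⁻¹ * v)
      (by rwa [Ne, inv_mul_eq_one])
    have hr1 := cs.isRightDescent_iff.1 hr
    have hur : cs.IsPrefix u (v * cs.simple r) ∧ cs.IsRightDescent v r := by
      have h1 := cs.length_mul_le u (u⁻¹ * (v * cs.simple r))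
      have h2 := cs.length_mul_simple v r
      unfold IsPrefix IsRightDescent at *
      simp only [mul_assoc, mul_inv_cancel_left] at *
      omega
    -- `r` is the last letter after `u`; if `r ≠ i`, then `r` and `i` commute, and the induction
    -- hypothesis applies to `v s_r`, which still has the descent `i`
    by_cases hri : r = i
    · exact Or.inl (hri ▸ hur.1)
    have hir := hi.mul_simple cs hM (Ne.symm hri) hur.2
    have hri' := hur.2.mul_simple cs hM hri hi
    have hc := cs.simple_mul_comm_of_eq_two (cs.eq_two_of_isRightDescent hM hri hur.2 hi)
    rcases ih hur.1 hir (by have := cs.isRightDescent_iff.1 hur.2; omega) with h1 | h1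
    · rw [mul_assoc, hc, ← mul_assoc] at h1
      exact Or.inl (h1.trans hri'.isPrefix)
    · exact Or.inr h1

theorem isFirm_iff (w : W) : cs.IsFirm w ↔
    ∃ i, cs.IsRightDescent w i ∧ ∀ j, cs.IsRightDescent w j → j = i := by
  constructor
  · rintro ⟨i, hi⟩
    have key (j : S) (hj : cs.IsRightDescent w j) : j = i := by
      obtain ⟨ω, -, hr, -, hw⟩ := cs.exists_isReduced_concat hj
      simpa using hi _ hr hw
    have hw : w ≠ 1 := by
      rintro rfl
      simpa using hi [] (by simp [IsReduced]) (by simp)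
    obtain ⟨j, hj⟩ := cs.exists_rightDescent_of_ne_one hw
    exact ⟨i, key j hj ▸ hj, key⟩
  · rintro ⟨i, hi, huniq⟩
    refine ⟨i, fun ω hω hw => ?_⟩
    rcases List.eq_nil_or_concat ω with rfl | ⟨ν, j, rfl⟩
    · subst hw
      exact absurd hi (by simpa using cs.not_isRightDescent_one i)
    · have : cs.IsRightDescent w j := by
        have h1 := hω.eq
        have h2 := cs.length_wordProd_le ν
        rw [hw] at h1
        rw [IsRightDescent, h1, ← hw]
        simpa [wordProd_append] using Nat.lt_succ_of_le h2
      simp [huniq j this]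

theorem firmness_le_iff (w : W) (n : ℕ) : cs.firmness w ≤ n ↔
    ∀ u, cs.IsPrefix u w → cs.IsFirm u → cs.length u ≤ n := by
  set A := {k : ℕ | ∃ u t : List S, cs.IsReduced (u ++ t) ∧ cs.wordProd (u ++ t) = w ∧
    u.length = k ∧ cs.IsFirm (cs.wordProd u)} with hA
  have hmem (k : ℕ) : k ∈ A ↔ ∃ u, cs.IsPrefix u w ∧ cs.IsFirm u ∧ cs.length u = k := by
    constructor
    · rintro ⟨α, β, h, hw, rfl, hf⟩
      have hα : cs.length (cs.wordProd α) = α.length := by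
        simpa [IsReduced] using h.take α.length
      exact ⟨_, (cs.isPrefix_iff _ _).2 ⟨α, β, h, hw, hα.symm, rfl⟩, hf, hα⟩
    · rintro ⟨u, hu, hf, rfl⟩
      obtain ⟨α, β, h, hw, hl, rfl⟩ := (cs.isPrefix_iff _ _).1 hu
      exact ⟨α, β, h, hw, hl, hf⟩
  have hb : BddAbove A := ⟨cs.length w, fun k hk => by
    obtain ⟨u, hu, -, rfl⟩ := (hmem k).1 hk; exact hu.length_le⟩
  constructor
  · intro h u hu hf
    exact (le_csSup hb ((hmem _).2 ⟨u, hu, hf, rfl⟩)).trans h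
  · intro h
    -- for `w = 1` the set is empty and its supremum in `ℕ` is `0`
    refine csSup_le' fun k hk => ?_
    obtain ⟨u, hu, hf, rfl⟩ := (hmem k).1 hk
    exact h u hu hf

theorem firmness_mono {u w : W} (h : cs.IsPrefix u w) : cs.firmness u ≤ cs.firmness w :=
  (cs.firmness_le_iff _ _).2 fun v hv hf => (cs.firmness_le_iff _ _).1 le_rfl v (hv.trans h) hf

/-- A firm prefix of an element with two descents `i ≠ j` avoids one of the two last letters. -/
theorem firmness_le_of_isRightDescent (hM : M.IsRightAngled) {w : W} {i j : S} (hij : i ≠ j)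
    (hi : cs.IsRightDescent w i) (hj : cs.IsRightDescent w j) {n : ℕ}
    (hni : cs.firmness (w * cs.simple i) ≤ n) (hnj : cs.firmness (w * cs.simple j) ≤ n) :
    cs.firmness w ≤ n := by
  rw [firmness_le_iff] at *
  intro u hu hf
  rcases hu.mul_simple_or cs hM hi with h | h
  · exact hni u h hf
  rcases hu.mul_simple_or cs hM hj with h' | h'
  · exact hnj u h' hf
  obtain ⟨k, -, hk⟩ := (cs.isFirm_iff u).1 hf
  exact absurd ((hk i h).trans (hk j h').symm) hij

open Classical in
/-- If a letter occurs `m` times in a word of `w`, then a shortest prefix of `w` with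
a word in which this letter occurs `m` times is firm. -/
theorem count_le_firmness (hM : M.IsRightAngled) (ω : List S) (hω : cs.IsReduced ω) (i : S) :
    ω.count i ≤ cs.firmness (cs.wordProd ω) := by
  induction hn : ω.length generalizing ω with
  | zero => simp [List.length_eq_zero_iff.1 hn]
  | succ n ih =>
    by_cases h : ∃ j, j ≠ i ∧ cs.IsRightDescent (cs.wordProd ω) j
    · obtain ⟨j, hji, hj⟩ := h
      obtain ⟨ω', hl, hw, hc⟩ := cs.exists_word_mul_simple hM hj
      rw [← hc i hji.symm]
      have hr : cs.IsReduced ω' := by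
        have := cs.isRightDescent_iff.1 hj
        rw [hw, hω.eq] at this
        rw [IsReduced]; omega
      refine (ih ω' hr (by omega)).trans ?_
      rw [← hw]
      exact cs.firmness_mono hj.isPrefix
    · push Not at h
      have h1 : cs.wordProd ω ≠ 1 := by
        intro h1
        have := hω.eq
        rw [h1, length_one] at this; omega
      obtain ⟨j, hj⟩ := cs.exists_rightDescent_of_ne_one h1
      have hji : j = i := by by_contra hn; exact h j hn hj
      subst hji
      have hf : cs.IsFirm (cs.wordProd ω) :=
        (cs.isFirm_iff _).2 ⟨j, hj, fun k hk => by by_contra hn; exact h k hn hk⟩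
      have := (cs.firmness_le_iff _ _).1 le_rfl _ (IsPrefix.refl _) hf
      rw [hω.eq] at this
      exact List.count_le_length.trans this

/-- In finite rank, the firmness grows at least linearly with the length. -/
theorem length_le_card_mul_firmness [Finite S] (hM : M.IsRightAngled) (w : W) :
    cs.length w ≤ Nat.card S * cs.firmness w := by
  classical
  have := Fintype.ofFinite S
  obtain ⟨ω, hω, rfl⟩ := cs.exists_isReduced w
  rw [hω.eq, Nat.card_eq_fintype_card, ← smul_eq_mul, ← Finset.card_univ,
    ← Multiset.coe_card, ← Multiset.sum_count_eq_card (s := Finset.univ) (by simp)]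
  exact Finset.sum_le_card_nsmul _ _ _ fun i _ => by
    simpa using cs.count_le_firmness hM ω hω i

end CoxeterSystem

/-! ### Galleries and the Weyl distance -/

namespace ChamberSystem

variable {S C : Type*} (Δ : ChamberSystem S C)

theorem existsGallery_append (ω ω' : List S) (x y : C) :
    Δ.ExistsGallery (ω ++ ω') x y ↔ ∃ z, Δ.ExistsGallery ω x z ∧ Δ.ExistsGallery ω' z y := by
  induction ω generalizing x with
  | nil => simp [ExistsGallery]
  | cons s ω ih =>
    simp only [List.cons_append, ExistsGallery, ih]
    constructor
    · rintro ⟨u, hu, z, h1, h2⟩; exact ⟨z, ⟨u, hu, h1⟩, h2⟩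
    · rintro ⟨z, ⟨u, hu, h1⟩, h2⟩; exact ⟨u, hu, z, h1, h2⟩

theorem ExistsGallery.reverse {ω : List S} {x y : C} (h : Δ.ExistsGallery ω x y) :
    Δ.ExistsGallery ω.reverse y x := by
  induction ω generalizing x with
  | nil => exact h.symm
  | cons s ω ih =>
    obtain ⟨z, hz, h⟩ := h
    rw [List.reverse_cons, existsGallery_append]
    exact ⟨z, ih h, x, hz.symm, rfl⟩

theorem ExistsGallery.exists_walk {ω : List S} {x y : C} (h : Δ.ExistsGallery ω x y) :
    ∃ γ : Δ.graph.Walk x y, γ.length = ω.length := by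
  induction ω generalizing x with
  | nil => cases h; exact ⟨.nil, rfl⟩
  | cons s ω ih =>
    obtain ⟨z, hz, h⟩ := h
    obtain ⟨γ, hγ⟩ := ih h
    exact ⟨.cons (SimpleGraph.iSup_adj.2 ⟨s, hz⟩) γ, congrArg (· + 1) hγ⟩

end ChamberSystem

namespace Building

variable {S W C : Type*} [Group W] {M : CoxeterMatrix S} {cs : CoxeterSystem M W}
  (Δ : Building cs C)

theorem δ_self (x : C) : Δ.δ x x = 1 := by
  simpa using (Δ.δ_eq_iff [] x x (by simp [CoxeterSystem.IsReduced])).2 rfl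

theorem δ_eq_simple_iff {s : S} {x y : C} : Δ.δ x y = cs.simple s ↔ (Δ.adj s).Adj x y := by
  simpa [ChamberSystem.ExistsGallery] using
    Δ.δ_eq_iff [s] x y (by simp [CoxeterSystem.IsReduced])

theorem δ_inv (x y : C) : (Δ.δ x y)⁻¹ = Δ.δ y x := by
  obtain ⟨ω, hω, h⟩ := cs.exists_isReduced (Δ.δ x y)
  rw [h, ← cs.wordProd_reverse]
  exact ((Δ.δ_eq_iff _ _ _ hω.reverse).2 ((Δ.δ_eq_iff _ _ _ hω).1 h).reverse).symm

theorem galleryDist_comm (x y : C) : Δ.galleryDist x y = Δ.galleryDist y x := by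
  rw [galleryDist, ← cs.length_inv, δ_inv, galleryDist]

/-- Factorizations of the Weyl distance without cancellation correspond to intermediate
chambers. -/
theorem δ_eq_mul_iff {a b : W} (h : cs.length (a * b) = cs.length a + cs.length b) (x y : C) :
    Δ.δ x y = a * b ↔ ∃ z, Δ.δ x z = a ∧ Δ.δ z y = b := by
  obtain ⟨α, hα, rfl⟩ := cs.exists_isReduced a
  obtain ⟨β, hβ, rfl⟩ := cs.exists_isReduced b
  have hr : cs.IsReduced (α ++ β) := by
    rw [CoxeterSystem.IsReduced, cs.wordProd_append, h, hα.eq, hβ.eq, List.length_append]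
  simp only [← cs.wordProd_append, Δ.δ_eq_iff _ _ _ hr, Δ.δ_eq_iff _ _ _ hα, Δ.δ_eq_iff _ _ _ hβ,
    ChamberSystem.existsGallery_append]

theorem δ_adj_of_lt {x y z : C} {s : S} (h : (Δ.adj s).Adj y z)
    (hl : cs.length (Δ.δ x y * cs.simple s) = cs.length (Δ.δ x y) + 1) :
    Δ.δ x z = Δ.δ x y * cs.simple s :=
  (Δ.δ_eq_mul_iff (by rw [hl, cs.length_simple]) x z).2 ⟨y, rfl, Δ.δ_eq_simple_iff.2 h⟩

/-- Along an `s`-edge the Weyl distance from a fixed chamber stays the same or is multiplied by the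
simple reflection `s`. -/
theorem δ_adj {x y z : C} {s : S} (h : (Δ.adj s).Adj y z) :
    Δ.δ x z = Δ.δ x y ∨ Δ.δ x z = Δ.δ x y * cs.simple s := by
  rcases cs.length_mul_simple (Δ.δ x y) s with hl | hl
  · exact Or.inr (Δ.δ_adj_of_lt h hl)
  · -- `y` lies in the `s`-panel of a chamber `u` that is closer to `x`
    obtain ⟨u, hu, huy⟩ := (Δ.δ_eq_mul_iff (a := Δ.δ x y * cs.simple s) (b := cs.simple s)
      (by simp [hl]) x y).1 (by simp)
    rw [δ_eq_simple_iff] at huy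
    by_cases huz : u = z
    · exact Or.inr (huz ▸ hu)
    · left
      have := Δ.δ_adj_of_lt (x := x) (Δ.panel_complete s u z (huy.reachable.trans h.reachable) huz)
        (by simp [hu, hl])
      simpa [hu] using this

theorem exists_δ_eq_mul_of_walk (x : C) {y z : C} (γ : Δ.graph.Walk y z) :
    ∃ g, Δ.δ x z = Δ.δ x y * g ∧ cs.length g ≤ γ.length := by
  induction γ with
  | nil => exact ⟨1, by simp⟩
  | cons h γ ih =>
    obtain ⟨g, hg, hl⟩ := ih
    obtain ⟨s, hs⟩ := SimpleGraph.iSup_adj.1 h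
    rcases Δ.δ_adj (x := x) hs with h1 | h1
    · exact ⟨g, by rw [hg, h1], by rw [SimpleGraph.Walk.length_cons]; omega⟩
    · refine ⟨cs.simple s * g, by rw [hg, h1, mul_assoc], ?_⟩
      have := cs.length_mul_le (cs.simple s) g
      rw [cs.length_simple] at this
      rw [SimpleGraph.Walk.length_cons]
      omega

theorem galleryDist_le_length {x y : C} (γ : Δ.graph.Walk x y) :
    Δ.galleryDist x y ≤ γ.length := by
  obtain ⟨g, hg, hl⟩ := Δ.exists_δ_eq_mul_of_walk x γ
  rwa [galleryDist, hg, δ_self, one_mul]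

theorem exists_walk_length_eq (x y : C) :
    ∃ γ : Δ.graph.Walk x y, γ.length = Δ.galleryDist x y := by
  obtain ⟨ω, hω, h⟩ := cs.exists_isReduced (Δ.δ x y)
  rw [galleryDist, h, hω.eq]
  exact ((Δ.δ_eq_iff _ _ _ hω).1 h).exists_walk

theorem isMinimalGallery_iff {x y : C} (γ : Δ.graph.Walk x y) :
    Δ.IsMinimalGallery γ ↔ γ.length = Δ.galleryDist x y := by
  constructor
  · intro h
    obtain ⟨γ', h'⟩ := Δ.exists_walk_length_eq x y
    exact le_antisymm (h' ▸ h γ') (Δ.galleryDist_le_length γ)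
  · intro h γ'
    exact h ▸ Δ.galleryDist_le_length γ'

theorem galleryDist_triangle (x y z : C) :
    Δ.galleryDist x z ≤ Δ.galleryDist x y + Δ.galleryDist y z := by
  obtain ⟨γ, hγ⟩ := Δ.exists_walk_length_eq x y
  obtain ⟨γ', hγ'⟩ := Δ.exists_walk_length_eq y z
  simpa [hγ, hγ'] using Δ.galleryDist_le_length (γ.append γ')

/-! ### Flexible chambers and the square closure -/

/-- The chambers on the minimal galleries from `c₀` to `c` are those whose Weyl distance from `c₀`
runs through the prefixes of `δ c₀ c`. -/
theorem isFlexible_iff (c₀ c : C) (n : ℕ) :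
    Δ.IsFlexible c₀ n c ↔ cs.firmness (Δ.δ c₀ c) ≤ n := by
  rw [cs.firmness_le_iff]
  constructor
  · rintro (h | h) u hu hf
    · exact hu.length_le.trans h
    · by_contra! hn
      obtain ⟨z, hz, hzc⟩ := (Δ.δ_eq_mul_iff (a := u) (b := u⁻¹ * Δ.δ c₀ c)
        (by simpa using hu.symm) c₀ c).1 (by simp)
      obtain ⟨γ, hγ⟩ := Δ.exists_walk_length_eq c₀ z
      obtain ⟨γ', hγ'⟩ := Δ.exists_walk_length_eq z c
      rw [galleryDist, hz] at hγ
      rw [galleryDist, hzc] at hγ'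
      refine h (γ.append γ') ?_ (cs.length u) hn (by simp [hγ]) ?_
      · rw [isMinimalGallery_iff, SimpleGraph.Walk.length_append, hγ, hγ']
        exact hu
      · rw [← hγ, SimpleGraph.Walk.getVert_append]
        simpa [IsFirm, hz] using hf
  · -- only firmness is used here, so this covers the chambers inside the ball as well
    intro h
    right
    intro γ hγ i hni hi hf
    rw [isMinimalGallery_iff] at hγ
    have h1 := Δ.galleryDist_le_length (γ.take i)
    obtain ⟨g, hg, hl⟩ := Δ.exists_δ_eq_mul_of_walk c₀ (γ.drop i)
    rw [SimpleGraph.Walk.take_length, min_eq_left hi, galleryDist] at h1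
    rw [SimpleGraph.Walk.drop_length] at hl
    rw [galleryDist] at hγ
    have h2 := cs.length_mul_le (Δ.δ c₀ (γ.getVert i)) g
    rw [← hg] at h2
    have := h _ (by rw [CoxeterSystem.IsPrefix, hg, inv_mul_cancel_left, ← hg]; omega) hf
    omega

theorem flex_eq (c₀ : C) (n : ℕ) : Δ.flex c₀ n = {c | cs.firmness (Δ.δ c₀ c) ≤ n} :=
  Set.ext fun c => Δ.isFlexible_iff c₀ c n

/-- Going up along an edge multiplies the Weyl distance, so going down is a descent. -/
theorem isRightDescent_of_adj {c₀ x y : C} {s : S} (h : (Δ.adj s).Adj y x) {k : ℕ}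
    (hx : Δ.galleryDist c₀ x = k) (hy : Δ.galleryDist c₀ y = k + 1) :
    cs.IsRightDescent (Δ.δ c₀ y) s ∧ Δ.δ c₀ x = Δ.δ c₀ y * cs.simple s := by
  rw [galleryDist] at hx hy
  rcases Δ.δ_adj (x := c₀) h with h | h
  · rw [h] at hx; omega
  · refine ⟨?_, h⟩
    rw [CoxeterSystem.IsRightDescent, ← h]; omega

theorem closedUnderSquares_firmness_le (hM : M.IsRightAngled) (c₀ : C) (n : ℕ) :
    Δ.ClosedUnderSquares c₀ {c | cs.firmness (Δ.δ c₀ c) ≤ n} := by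
  rintro k s t c₁ c₂ c₃ c₄ hst - h₁ h₂ - - - h₃ a₃ a₄
  obtain ⟨d₁, e₁⟩ := Δ.isRightDescent_of_adj a₃ h₁.2 h₃
  obtain ⟨d₂, e₂⟩ := Δ.isRightDescent_of_adj a₄ h₂.2 h₃
  exact cs.firmness_le_of_isRightDescent hM hst.symm d₁ d₂ (e₁ ▸ h₁.1) (e₂ ▸ h₂.1)

/-- A chamber outside the ball with firmness at most `n` is not firm, so it is the top of a square
whose other three chambers have firmness at most `n` as well. -/
theorem mem_of_firmness_le (hM : M.IsRightAngled) {c₀ : C} {n : ℕ} {T : Set C}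
    (hB : Δ.ball c₀ n ⊆ T) (hT : Δ.ClosedUnderSquares c₀ T) (c : C)
    (hc : cs.firmness (Δ.δ c₀ c) ≤ n) : c ∈ T := by
  induction hk : Δ.galleryDist c₀ c using Nat.strong_induction_on generalizing c with
  | _ k ih =>
    by_cases hkn : k ≤ n
    · exact hB (show Δ.galleryDist c₀ c ≤ n from hk ▸ hkn)
    subst hk
    set w := Δ.δ c₀ c with hw
    have hlw : Δ.galleryDist c₀ c = cs.length w := rfl
    rw [hlw] at hkn ih
    obtain ⟨i, hi⟩ := cs.exists_rightDescent_of_ne_one (w := w)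
      (by intro h; rw [h, cs.length_one] at hkn; omega)
    have hf : ¬ cs.IsFirm w := fun hf =>
      hkn ((cs.firmness_le_iff w n).1 hc w (CoxeterSystem.IsPrefix.refl w) hf)
    obtain ⟨j, hj, hji⟩ : ∃ j, cs.IsRightDescent w j ∧ j ≠ i := by
      by_contra! h
      exact hf ((cs.isFirm_iff w).2 ⟨i, hi, h⟩)
    have hm := cs.eq_two_of_isRightDescent hM hji.symm hi hj
    have hcomm := cs.simple_mul_comm_of_eq_two hm
    have hi' := hi.mul_simple cs hM hji.symm hj
    have l₁ := cs.isRightDescent_iff.1 hi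
    have l₂ := cs.isRightDescent_iff.1 hj
    have l₃ := cs.isRightDescent_iff.1 hi'
    -- lift the factorization `w = v s_i s_j = v s_j s_i` to a square with bottom `c₄` and top `c`
    set v := w * cs.simple j * cs.simple i with hv
    have hwv : w = v * (cs.simple i * cs.simple j) := by simp [hv, mul_assoc]
    have hij : cs.length (cs.simple i * cs.simple j) = 2 := by
      have h1 := cs.length_mul_le v (cs.simple i * cs.simple j)
      have h2 := cs.length_mul_le (cs.simple i) (cs.simple j)
      rw [← hwv] at h1
      rw [cs.length_simple, cs.length_simple] at h2
      omega
    obtain ⟨c₄, h₄, h₄c⟩ := (Δ.δ_eq_mul_iff (by rw [← hwv]; omega) c₀ c).1 hwv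
    obtain ⟨c₁, h₁, h₁c⟩ := (Δ.δ_eq_mul_iff (by rw [hij]; simp) c₄ c).1 h₄c
    obtain ⟨c₂, h₂, h₂c⟩ := (Δ.δ_eq_mul_iff (by rw [← hcomm, hij]; simp) c₄ c).1
      (h₄c.trans hcomm)
    rw [δ_eq_simple_iff] at h₁ h₂ h₁c h₂c
    have e₁ : Δ.δ c₀ c₁ = w * cs.simple j := by
      have : v * cs.simple i = w * cs.simple j := by simp [hv]
      rw [Δ.δ_adj_of_lt (x := c₀) h₁ (by rw [h₄, this]; omega), h₄, this]
    have e₂ : Δ.δ c₀ c₂ = w * cs.simple i := by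
      have : v * cs.simple j = w * cs.simple i := by
        rw [hv, mul_assoc, mul_assoc, hcomm]; simp
      rw [Δ.δ_adj_of_lt (x := c₀) h₂ (by rw [h₄, this]; omega), h₄, this]
    have key (x : C) (u : W) (hx : Δ.δ c₀ x = u) (hu : cs.IsPrefix u w)
        (hl : cs.length u < cs.length w) : x ∈ T :=
      ih _ hl x (hx ▸ (cs.firmness_mono hu).trans hc) (congrArg cs.length hx)
    refine hT (cs.length v) i j c₁ c₂ c c₄ hji.symm hm
      ⟨key _ _ e₁ hj.isPrefix (by omega), ?_⟩ ⟨key _ _ e₂ hi.isPrefix (by omega), ?_⟩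
      ⟨key _ _ h₄ (hi'.isPrefix.trans hj.isPrefix) (by omega), congrArg cs.length h₄⟩
      h₁ h₂ ?_ h₁c.symm h₂c.symm
    · change cs.length _ = _
      rw [e₁]; omega
    · change cs.length _ = _
      rw [e₂]; omega
    · change cs.length w = _
      omega

theorem squareClosure_ball_eq (hM : M.IsRightAngled) (c₀ : C) (n : ℕ) :
    Δ.squareClosure c₀ (Δ.ball c₀ n) = {c | cs.firmness (Δ.δ c₀ c) ≤ n} := by
  have h := Δ.isLeast_squareClosure c₀ (Δ.ball c₀ n)
  refine Set.Subset.antisymm (h.2 ⟨fun c hc => ?_, Δ.closedUnderSquares_firmness_le hM c₀ n⟩)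
    fun c hc => Δ.mem_of_firmness_le hM h.1.1 h.1.2 c hc
  exact (cs.firmness_le_iff _ _).2 fun u hu _ => hu.length_le.trans hc

theorem isBounded_firmness_le [Finite S] (hM : M.IsRightAngled) (c₀ : C) (n : ℕ) :
    Δ.IsBounded {c | cs.firmness (Δ.δ c₀ c) ≤ n} := by
  have key (x : C) (hx : cs.firmness (Δ.δ c₀ x) ≤ n) : Δ.galleryDist c₀ x ≤ Nat.card S * n :=
    (cs.length_le_card_mul_firmness hM _).trans (Nat.mul_le_mul_left _ hx)
  refine ⟨Nat.card S * n + Nat.card S * n, fun x hx y hy => ?_⟩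
  have h := Δ.galleryDist_triangle x c₀ y
  rw [Δ.galleryDist_comm x c₀] at h
  exact h.trans (Nat.add_le_add (key x hx) (key y hy))

end Building

theorem mainTheorem3 {S W C : Type*} [Finite S] [Group W] {M : CoxeterMatrix S}
    (hM : M.IsRightAngled) (cs : CoxeterSystem M W) (Δ : Building cs C) (c₀ : C) (n : ℕ) :
    Δ.squareClosure c₀ (Δ.ball c₀ n) = Δ.flex c₀ n ∧
      Δ.flex c₀ n = {c : C | cs.firmness (Δ.δ c₀ c) ≤ n} ∧
      Δ.IsBounded (Δ.flex c₀ n) := by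
  rw [Δ.flex_eq]
  exact ⟨Δ.squareClosure_ball_eq hM c₀ n, rfl, Δ.isBounded_firmness_le hM c₀ n⟩
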